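/- All Hilbert spaces are finite-dimensional. Let $A,B$ be Hilbert spaces, write $\mathrm{L}(A)$ for the linear operators on $A$, and for a state $\rho$ and a non-negative operator $\sigma$ put $D(\rho\|\sigma)=\mathrm{tr}\,\rho(\log\rho-\log\sigma)$ if $\mathrm{supp}(\rho)\subseteq\mathrm{supp}(\sigma)$ and $D(\rho\|\sigma)=+\infty$ otherwise (logarithms and inverse powers of non-negative operators are taken on their supports). For a linear map $\mathcal N:\mathrm{L}(A)\to\mathrm{L}(B)$ let $\mathcal N^\dagger$ be its adjoint for the Hilbert–Schmidt inner product; $\mathcal N$ is called tensor-stable positive if $\mathcal N^{\otimes n}$ maps non-negative operators to non-negative operators for every $n\in\mathbb N$. For a self-adjoint operator $H$ with distinct eigenvalues $\mu_x$, $x\in S$, and orthogonal projectors $P_x$ onto the corresponding eigenspaces, and for $n\in\mathbb N$, let $\Lambda_n$ be the set of functions $\lambda:S\to\mathbb N_0$ with $\sum_x\lambda_x=n$ (the types), let $P_\lambda=\sum P_{x_1}\otimes\cdots\otimes P_{x_n}$, where the sum is over all sequences $(x_1,\dots,x_n)\in S^n$ in which each $x\in S$ occurs exactly $\lambda_x$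 times, and let $\mathcal P_{H,n}(K)=\sum_{\lambda\in\Lambda_n}P_\lambda K P_\lambda$ be the pinching map. For $\sigma\ge 0$ let $\mathcal T_{\sigma,\mathcal N}(X)=\sigma^{1/2}\,\mathcal N^\dagger\bigl(\mathcal N(\sigma)^{-1/2}X\,\mathcal N(\sigma)^{-1/2}\bigr)\,\sigma^{1/2}$ be the Petz recovery map, and let $$\mathcal R^n_{\sigma,\mathcal N}=\mathcal P_{\sigma,n}\circ(\mathcal T_{\sigma,\mathcal N})^{\otimes n}\circ\mathcal P_{\mathcal N(\sigma),n}$$ be the pinching recovery map. **Proposition.** Let $\sigma$ be a non-negative operator on $A$, let $\mathcal N:\mathrm{L}(A)\to\mathrm{L}(B)$ be a trace-preserving tensor-stable positive linear map, and let $\rho$ be a density operator on $A$. If $\mathrm{supp}(\rho)\subseteq\mathrm{supp}(\sigma)$, then $$D(\rho\|\sigma)-D\bigl(\mathcal N(\rho)\big\|\mathcal N(\sigma)\bigr)\;\ge\;\liminf_{n\to\infty}\frac1n\,D\bigl(\rho^{\otimes n}\,\big\|\,(\mathcal R^n_{\sigma,\mathcal N}\circ\mathcal N^{\otimes n})(\rho^{\otimes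 n})\bigr).$$ Moreover, whether or not $\mathrm{supp}(\rho)\subseteq\mathrm{supp}(\sigma)$, the data-processing inequality $D(\mathcal N(\rho)\|\mathcal N(\sigma))\le D(\rho\|\sigma)$ holds. -/

import Mathlib

open scoped Matrix ComplexOrder
open Filter

noncomputable section

namespace QInfo

/-! Operators on a finite-dimensional Hilbert space are written as complex matrices in an
orthonormal basis indexed by a finite type `a`; the space `A^{⊗n}` has the product basis indexed
by `Fin n → a`. Functions of Hermitian matrices are taken with the continuous functional calculus
`cfc` (spectra are finite, so every real function is admissible). -/

variable {a b : Type*} [Fintype a] [DecidableEq a]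

/-- Matrices `Matrix a a ℂ`, viewed as operators on the Hilbert space with basis `a`. -/
abbrev Op (a : Type*) : Type _ := Matrix a a ℂ

/-- The set of states: positive semidefinite matrices with trace one. -/
def IsState (ρ : Op a) : Prop := ρ.PosSemidef ∧ ρ.trace = 1

/-- The support of a Hermitian matrix, i.e. the orthogonal complement of its kernel; for Hermitian
matrices this is the range. -/
def supp (X : Op a) : Submodule ℂ (a → ℂ) := LinearMap.range X.mulVecLin

/-- The (natural) logarithm of a positive semidefinite matrix, equal to `0` on its kernel. -/
def mlog (X : Op a) : Op a := cfc Real.log X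

/-- The square root of a positive semidefinite matrix. -/
def msqrt (X : Op a) : Op a := cfc Real.sqrt X

/-- The inverse square root of a positive semidefinite matrix, taken on its support
(and `0` on its kernel). -/
def minvSqrt (X : Op a) : Op a := cfc (fun t : ℝ => (Real.sqrt t)⁻¹) X

open scoped Classical in
/-- The relative entropy `D(ρ‖σ) = tr (ρ (log ρ - log σ))` if `supp ρ ⊆ supp σ`, and `+∞`
otherwise. -/
def relEntropy (ρ σ : Op a) : EReal :=
  if supp ρ ≤ supp σ then (((ρ * (mlog ρ - mlog σ)).trace.re : ℝ) : EReal) else ⊤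

/-! ### Tensor products -/

/-- The tensor product `X₁ ⊗ ⋯ ⊗ Xₙ`, with entries `∏ i, Xᵢ (f i) (g i)`. -/
def tensor {n : ℕ} (X : Fin n → Op a) : Op (Fin n → a) :=
  Matrix.of fun f g => ∏ i, X i (f i) (g i)

/-- The tensor power `X^{⊗n}`. -/
def tensorPow (n : ℕ) (X : Op a) : Op (Fin n → a) := tensor fun _ => X

/-- The tensor power `N^{⊗n}` of a linear map: the linear map sending the matrix unit
`⊗ᵢ |f i⟩⟨g i|` to `⊗ᵢ N (|f i⟩⟨g i|)`. -/
def tensorMap (n : ℕ) (N : Op a →ₗ[ℂ] Op b) : Op (Fin n → a) →ₗ[ℂ] Op (Fin n → b) where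
  toFun X := ∑ f : Fin n → a, ∑ g : Fin n → a,
    X f g • tensor fun i => N (Matrix.single (f i) (g i) 1)
  map_add' X Y := by simp only [Matrix.add_apply, add_smul, Finset.sum_add_distrib]
  map_smul' c X := by
    simp only [Matrix.smul_apply, smul_eq_mul, mul_smul, Finset.smul_sum, RingHom.id_apply]

/-- `N^{⊗n} (X₁ ⊗ ⋯ ⊗ Xₙ) = N X₁ ⊗ ⋯ ⊗ N Xₙ`. -/
theorem tensorMap_tensor (n : ℕ) (N : Op a →ₗ[ℂ] Op b) (X : Fin n → Op a) :
    tensorMap n N (tensor X) = tensor fun i => N (X i) := by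
  have key : ∀ (Y : Op a) (p q : b),
      N Y p q = ∑ s : a × a, Y s.1 s.2 * N (Matrix.single s.1 s.2 1) p q := by
    intro Y p q
    conv_lhs => rw [Matrix.matrix_eq_sum_single Y]
    have h : ∀ i j, Matrix.single i j (Y i j) = Y i j • Matrix.single i j (1 : ℂ) := by
      intro i j; simp
    simp only [h, map_sum, map_smul, Matrix.sum_apply, Matrix.smul_apply, smul_eq_mul]
    rw [Fintype.sum_prod_type]
  ext p q
  simp only [tensorMap, tensor, LinearMap.coe_mk, AddHom.coe_mk, Matrix.sum_apply,
    Matrix.smul_apply, Matrix.of_apply, smul_eq_mul]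
  simp only [key (X _)]
  rw [Finset.prod_univ_sum, Fintype.piFinset_univ, ← Fintype.sum_prod_type',
    ← (Equiv.arrowProdEquivProdArrow (Fin n) (fun _ => a) (fun _ => a)).sum_comp]
  refine Finset.sum_congr rfl fun x _ => ?_
  rw [← Finset.prod_mul_distrib]
  rfl

/-! ### Maps between matrix algebras -/

variable [Fintype b] [DecidableEq b]

/-- Positive maps send positive semidefinite matrices to positive semidefinite matrices. -/
def IsPositiveMap (N : Op a →ₗ[ℂ] Op b) : Prop :=
  ∀ X : Op a, X.PosSemidef → (N X).PosSemidef

/-- `N` is tensor-stable positive if `N^{⊗n}` is positive for every `n`. -/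
def IsTensorStablePositive (N : Op a →ₗ[ℂ] Op b) : Prop :=
  ∀ n : ℕ, IsPositiveMap (tensorMap n N)

/-- `N` preserves the trace. -/
def IsTracePreserving (N : Op a →ₗ[ℂ] Op b) : Prop :=
  ∀ X : Op a, (N X).trace = X.trace

/-- The adjoint `N†` with respect to the Hilbert-Schmidt inner product `⟨X, Y⟩ = tr (Xᴴ Y)`. -/
def adjointMap (N : Op a →ₗ[ℂ] Op b) : Op b →ₗ[ℂ] Op a where
  toFun Y := Matrix.of fun i j => ((N (Matrix.single i j 1))ᴴ * Y).trace
  map_add' X Y := by ext i j; simp [Matrix.mul_add]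
  map_smul' c X := by ext i j; simp

/-- The defining property of the adjoint. -/
theorem trace_adjointMap (N : Op a →ₗ[ℂ] Op b) (X : Op a) (Y : Op b) :
    (Xᴴ * adjointMap N Y).trace = ((N X)ᴴ * Y).trace := by
  have h : ∀ i j, Matrix.single i j (X i j) = X i j • Matrix.single i j (1 : ℂ) := by
    intro i j; simp
  conv_rhs => rw [Matrix.matrix_eq_sum_single X]
  simp only [h, map_sum, map_smul, Matrix.conjTranspose_sum, Matrix.conjTranspose_smul,
    Matrix.sum_mul, Matrix.trace_sum, Matrix.smul_mul, Matrix.trace_smul, smul_eq_mul]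
  rw [Finset.sum_comm]
  simp [Matrix.trace, Matrix.mul_apply, adjointMap]

/-- The Petz recovery map `X ↦ σ^{1/2} N†(N(σ)^{-1/2} X N(σ)^{-1/2}) σ^{1/2}`. -/
def petz (σ : Op a) (N : Op a →ₗ[ℂ] Op b) : Op b →ₗ[ℂ] Op a where
  toFun X := msqrt σ * adjointMap N (minvSqrt (N σ) * X * minvSqrt (N σ)) * msqrt σ
  map_add' X Y := by simp only [Matrix.mul_add, Matrix.add_mul, map_add]
  map_smul' c X := by simp only [Matrix.mul_smul, Matrix.smul_mul, map_smul, RingHom.id_apply]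

/-! ### Pinching -/

/-- The finite set of distinct eigenvalues of a Hermitian matrix. -/
def eigs (H : Op a) : Finset ℝ := (Matrix.finite_real_spectrum (A := H)).toFinset

/-- The orthogonal projector onto the eigenspace of the Hermitian matrix `H` for the
eigenvalue `μ`. -/
def eigProj (H : Op a) (μ : ℝ) : Op a := cfc (fun t : ℝ => if t = μ then (1 : ℝ) else 0) H

/-- The set `Λ_n` of types of sequences of length `n` with symbols in the set of distinct
eigenvalues of `H`: the functions `l` to `ℕ` with `∑ x, l x = n`. -/
def types (n : ℕ) (H : Op a) : Finset (eigs H → ℕ) := Finset.piAntidiag Finset.univ n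

/-- The projector `P_l`: the sum of `P_{x₁} ⊗ ⋯ ⊗ P_{xₙ}` over all sequences of eigenvalues
in which each `y` occurs exactly `l y` times. -/
def typeProj (n : ℕ) (H : Op a) (l : eigs H → ℕ) : Op (Fin n → a) :=
  ∑ x : Fin n → eigs H with ∀ y, (Finset.univ.filter fun i => x i = y).card = l y,
    tensor fun i => eigProj H (x i)

/-- The pinching map `K ↦ ∑_{l ∈ Λ_n} P_l K P_l`. -/
def pinching (n : ℕ) (H : Op a) : Op (Fin n → a) →ₗ[ℂ] Op (Fin n → a) where
  toFun K := ∑ l ∈ types n H, typeProj n H l * K * typeProj n H l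
  map_add' X Y := by simp only [Matrix.mul_add, Matrix.add_mul, Finset.sum_add_distrib]
  map_smul' c X := by
    simp only [Matrix.mul_smul, Matrix.smul_mul, Finset.smul_sum, RingHom.id_apply]

/-- The pinching recovery map: pinching with respect to `N σ`, followed by the `n`-th tensor power
of the Petz recovery map, followed by pinching with respect to `σ`. -/
def pinchingRecovery (n : ℕ) (σ : Op a) (N : Op a →ₗ[ℂ] Op b) :
    Op (Fin n → b) →ₗ[ℂ] Op (Fin n → a) :=
  pinching n σ ∘ₗ tensorMap n (petz σ N) ∘ₗ pinching n (N σ)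

end QInfo

end

open QInfo

namespace QInfo

open scoped MatrixOrder

variable {a b ι κ : Type*} [Fintype a] [DecidableEq a] [Fintype b] [DecidableEq b]
  [Fintype ι] [Fintype κ]

/-! ### Supports and traces of products -/

/-! Pinching makes the non-commuting parts of the problem commute at a cost that is only polynomial
in `n`. Write Φ for the adjoint of N^{⊗n}; it is positive and unital. The pinched output τ of
N(ρ)^{⊗n} commutes with N(σ)^{⊗n}, so the inner sandwich of the Petz map collapses to X = τ ·
(N(σ)^{-1})^{⊗n}. The outer pinching gives Z commuting with σ^{⊗n}, and the recovered operator is W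
= Z σ^{⊗n}. Logarithms of both products split on the relevant supports (`trace_mul_mlog_mul`).

It remains to bound tr ρ^{⊗n} log Z from below. The pinching inequality
(`smul_pinching_sub_posSemidef`) gives Φ(X) ≤ poly(n) Z and N(ρ)^{⊗n} ≤ poly(n) τ. Operator
monotonicity of log and the Jensen inequality Φ(log X) ≤ log Φ(X), merged in `trace_mul_mlog_le`,
transfer these bounds to logarithms. Additivity over tensor powers then yields D(ρ^{⊗n}‖W) ≤ n
(D(ρ‖σ) − D(N(ρ)‖N(σ))) + O(log n) (`pinchingRecovery_estimate`). Dividing by n gives the recovery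
bound. Since tr W = 1, Klein's inequality makes the left side non-negative, and data processing
follows.

Jensen's inequality needs only positivity of Φ, because it is applied through the spectral
projectors of a single operator. It is proved for resolvents and integrated to the logarithm under
the trace; the regularization ε → 0 also yields the support inclusions. -/

theorem supp_le_supp_iff {X Y : Op a} : supp X ≤ supp Y ↔ ∃ M, X = Y * M := by
  constructor
  · intro h
    have h1 : ∀ j, ∃ v, Y *ᵥ v = X.col j := fun j => by
      have : X.col j ∈ supp X := ⟨Pi.single j 1, by simp⟩
      simpa [supp] using h this
    choose v hv using h1
    refine ⟨Matrix.of fun i j => v j i, ?_⟩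
    ext i j
    simpa [Matrix.mul_apply, Matrix.mulVec, dotProduct] using (congrFun (hv j) i).symm
  · rintro ⟨M, rfl⟩ _ ⟨v, rfl⟩
    exact ⟨M *ᵥ v, by simp⟩

theorem _root_.Matrix.PosSemidef.exists_eq_conjTranspose_mul_self {X : Op a}
    (hX : X.PosSemidef) : ∃ C : Op a, X = Cᴴ * C :=
  CStarAlgebra.nonneg_iff_eq_star_mul_self.mp hX.nonneg

theorem trace_mul_nonneg {X Y : Op a} (hX : X.PosSemidef) (hY : Y.PosSemidef) :
    0 ≤ (X * Y).trace := by
  obtain ⟨C, rfl⟩ := hY.exists_eq_conjTranspose_mul_self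
  rw [← Matrix.mul_assoc, Matrix.trace_mul_comm, ← Matrix.mul_assoc]
  exact (hX.mul_mul_conjTranspose_same C).trace_nonneg

theorem trace_mul_re_nonneg {X Y : Op a} (hX : X.PosSemidef) (hY : Y.PosSemidef) :
    0 ≤ (X * Y).trace.re :=
  (Complex.le_def.mp (trace_mul_nonneg hX hY)).1

/-- With X = D*D and Y = C*C the trace is the squared Hilbert–Schmidt norm of DC*. -/
theorem mul_eq_zero_of_trace_re_eq_zero {X Y : Op a} (hX : X.PosSemidef) (hY : Y.PosSemidef)
    (h : (X * Y).trace.re = 0) : X * Y = 0 := by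
  have h0 : (X * Y).trace = 0 :=
    Complex.ext h (Complex.le_def.mp (trace_mul_nonneg hX hY)).2.symm
  obtain ⟨C, rfl⟩ := hY.exists_eq_conjTranspose_mul_self
  obtain ⟨D, rfl⟩ := hX.exists_eq_conjTranspose_mul_self
  have h1 : ((D * Cᴴ)ᴴ * (D * Cᴴ)).trace = 0 := by
    rw [← h0, Matrix.conjTranspose_mul, Matrix.conjTranspose_conjTranspose, ← Matrix.mul_assoc,
      Matrix.trace_mul_comm, ← Matrix.mul_assoc, ← Matrix.mul_assoc, ← Matrix.mul_assoc,
      Matrix.mul_assoc (Cᴴ * C), Matrix.trace_mul_comm (Cᴴ * C), ← Matrix.mul_assoc (Dᴴ * D)]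
  have h2 := Matrix.trace_conjTranspose_mul_self_eq_zero_iff.mp h1
  rw [Matrix.mul_assoc, ← Matrix.mul_assoc D, h2]
  simp

theorem trace_re_mono {ρ X Y : Op a} (hρ : ρ.PosSemidef) (h : (Y - X).PosSemidef) :
    (ρ * X).trace.re ≤ (ρ * Y).trace.re := by
  have := trace_mul_re_nonneg hρ h
  rw [Matrix.mul_sub, Matrix.trace_sub, Complex.sub_re] at this
  linarith

/-! ### Spectral decompositions -/

theorem continuousOn_spectrum (H : Op a) (f : ℝ → ℝ) : ContinuousOn f (spectrum ℝ H) :=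
  (Matrix.finite_real_spectrum (A := H)).continuousOn f

theorem cfc_isHermitian (f : ℝ → ℝ) (H : Op a) : (cfc f H).IsHermitian :=
  cfc_predicate f H

theorem cfc_posSemidef {f : ℝ → ℝ} {H : Op a} (h : ∀ s : eigs H, 0 ≤ f s) :
    (cfc f H).PosSemidef := by
  rw [← Matrix.nonneg_iff_posSemidef]
  exact cfc_nonneg fun x hx => h ⟨x, by simpa [eigs] using hx⟩

theorem eigProj_posSemidef (H : Op a) (s : ℝ) : (eigProj H s).PosSemidef :=
  cfc_posSemidef fun t => by split_ifs <;> simp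

theorem eigs_nonneg {H : Op a} (hH : H.PosSemidef) (s : eigs H) : 0 ≤ (s : ℝ) := by
  have hs : (s : ℝ) ∈ spectrum ℝ H := by simpa [eigs] using s.2
  exact spectrum_nonneg_of_nonneg hH.nonneg hs

theorem cfc_eq_sum_eigProj (H : Op a) (f : ℝ → ℝ) :
    cfc f H = ∑ s : eigs H, (f s : ℂ) • eigProj H s := by
  have h : (spectrum ℝ H).EqOn f (∑ s : eigs H, fun t => f s * if t = s then 1 else 0) := by
    intro t ht
    have ht' : t ∈ eigs H := by simpa [eigs] using ht
    rw [Finset.sum_apply, Finset.sum_eq_single ⟨t, ht'⟩]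
    · simp
    · rintro ⟨s, hs⟩ - hst
      have : t ≠ s := fun h => hst (by simp [h])
      simp [this]
    · simp
  rw [cfc_congr h, cfc_sum_univ _ _ fun s => continuousOn_spectrum _ _]
  refine Finset.sum_congr rfl fun s _ => ?_
  rw [cfc_const_mul _ _ _ (continuousOn_spectrum _ _)]
  ext i j
  simp [eigProj]

theorem eq_sum_eigProj {H : Op a} (hH : H.IsHermitian) :
    H = ∑ s : eigs H, ((s : ℝ) : ℂ) • eigProj H s := by
  conv_lhs => rw [← cfc_id ℝ H hH.isSelfAdjoint]
  exact cfc_eq_sum_eigProj H id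

theorem sum_eigProj {H : Op a} (hH : H.IsHermitian) : ∑ s : eigs H, eigProj H s = 1 := by
  have := cfc_eq_sum_eigProj H fun _ => 1
  rw [cfc_const_one ℝ H hH.isSelfAdjoint] at this
  simpa using this.symm

theorem cfc_mul_eigProj (H : Op a) (f : ℝ → ℝ) (s : ℝ) :
    cfc f H * eigProj H s = (f s : ℂ) • eigProj H s := by
  rw [eigProj, ← cfc_mul _ _ _ (continuousOn_spectrum _ _) (continuousOn_spectrum _ _)]
  have : (fun t : ℝ => f t * if t = s then 1 else 0) = fun t => f s * if t = s then 1 else 0 := by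
    ext t
    split_ifs with h <;> simp [h]
  rw [this, cfc_const_mul _ _ _ (continuousOn_spectrum _ _)]
  ext i j
  simp

theorem eigProj_mul_cfc (H : Op a) (f : ℝ → ℝ) (s : ℝ) :
    eigProj H s * cfc f H = (f s : ℂ) • eigProj H s := by
  rw [eigProj, (cfc_commute_cfc _ f H).eq]
  exact cfc_mul_eigProj H f s

theorem eigProj_mul_eigProj (H : Op a) (s t : ℝ) :
    eigProj H s * eigProj H t = if t = s then eigProj H t else 0 := by
  rw [eigProj, cfc_mul_eigProj]
  split_ifs <;> simp

/-- A finite decomposition of the identity into mutually orthogonal projectors which diagonalizes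
a matrix also diagonalizes every function of it. -/
theorem cfc_eq_sum_smul {H : Op a} (hH : H.IsHermitian) {Q : ι → Op a} {c : ι → ℝ}
    (hQ : ∑ i, Q i = 1) (hc : ∀ i, H * Q i = (c i : ℂ) • Q i) (f : ℝ → ℝ) :
    cfc f H = ∑ i, (f (c i) : ℂ) • Q i := by
  have key : ∀ (s : ℝ) (i : ι),
      (f s : ℂ) • (eigProj H s * Q i) = (f (c i) : ℂ) • (eigProj H s * Q i) := by
    intro s i
    by_cases h : s = c i
    · rw [h]
    -- The operator E_s H Q_i, with E_s the spectral projector, is evaluated from both sides;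
    -- distinct eigenvalues force E_s Q_i = 0.
    · have h1 : (s : ℂ) • (eigProj H s * Q i) = (c i : ℂ) • (eigProj H s * Q i) := by
        rw [← Matrix.mul_smul _ (c i : ℂ), ← hc, ← Matrix.mul_assoc, ← Matrix.smul_mul]
        congr 1
        conv_rhs => rw [← cfc_id ℝ H hH.isSelfAdjoint]
        have := eigProj_mul_cfc H id s
        simpa [cfc_id ℝ H hH.isSelfAdjoint] using this.symm
      have h2 : ((s : ℂ) - c i) • (eigProj H s * Q i) = 0 := by rw [sub_smul, h1, sub_self]
      rcases smul_eq_zero.mp h2 with h3 | h3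
      · exact absurd (by exact_mod_cast sub_eq_zero.mp h3) h
      · rw [h3]; simp
  calc cfc f H = cfc f H * ∑ i, Q i := by rw [hQ, Matrix.mul_one]
    _ = ∑ i, ∑ s : eigs H, (f (c i) : ℂ) • (eigProj H s * Q i) := by
        rw [cfc_eq_sum_eigProj, Matrix.mul_sum]
        refine Finset.sum_congr rfl fun i _ => ?_
        rw [Matrix.sum_mul]
        exact Finset.sum_congr rfl fun s _ => by rw [Matrix.smul_mul, key]
    _ = _ := by
        refine Finset.sum_congr rfl fun i _ => ?_
        rw [← Finset.smul_sum, ← Matrix.sum_mul, sum_eigProj hH, Matrix.one_mul]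

theorem trace_mul_cfc (ρ H : Op a) (f : ℝ → ℝ) :
    (ρ * cfc f H).trace.re = ∑ s : eigs H, f s * (ρ * eigProj H s).trace.re := by
  simp [cfc_eq_sum_eigProj, Matrix.mul_sum, Matrix.trace_sum]

theorem sum_trace_mul_eigProj (ρ : Op a) {H : Op a} (hH : H.IsHermitian) :
    ∑ s : eigs H, (ρ * eigProj H s).trace.re = ρ.trace.re := by
  rw [← Complex.re_sum, ← Matrix.trace_sum, ← Matrix.mul_sum, sum_eigProj hH, Matrix.mul_one]

theorem cfc_fun_id {H : Op a} (hH : H.IsHermitian) : cfc (fun t : ℝ => t) H = H :=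
  cfc_id' ℝ H hH.isSelfAdjoint

theorem mul_cfc {H : Op a} (hH : H.IsHermitian) (f : ℝ → ℝ) :
    H * cfc f H = cfc (fun t : ℝ => t * f t) H := by
  rw [cfc_mul _ _ _ (continuousOn_spectrum _ _) (continuousOn_spectrum _ _), cfc_fun_id hH]

/-- Since 0⁻¹ = 0, `cfc (fun t => t⁻¹) H` is the inverse on the support, and its product with H is
the support projector, which fixes ρ. -/
theorem mul_cfc_inv_mul {ρ H : Op a} (hH : H.IsHermitian) (h : supp ρ ≤ supp H) :
    H * (cfc (fun t : ℝ => t⁻¹) H * ρ) = ρ := by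
  obtain ⟨M, rfl⟩ := supp_le_supp_iff.mp h
  have h1 : H * cfc (fun t : ℝ => t⁻¹) H * H = H := by
    conv_lhs => enter [2]; rw [← cfc_fun_id hH]
    conv_rhs => rw [← cfc_fun_id hH]
    rw [mul_cfc hH, ← cfc_mul _ _ _ (continuousOn_spectrum _ _) (continuousOn_spectrum _ _)]
    refine cfc_congr fun t _ => ?_
    by_cases ht : t = 0
    · simp [ht]
    · simp [ht]
  rw [← Matrix.mul_assoc, ← Matrix.mul_assoc, h1]

/-- The support condition in terms of the spectral weights. -/
theorem supp_le_supp_iff_trace {ρ H : Op a} (hρ : ρ.PosSemidef) (hH : H.IsHermitian) :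
    supp ρ ≤ supp H ↔ ∀ s : eigs H, (s : ℝ) = 0 → (ρ * eigProj H s).trace.re = 0 := by
  rw [supp_le_supp_iff]
  constructor
  · rintro ⟨M, rfl⟩ s hs
    have : eigProj H s * H = 0 := by
      have := eigProj_mul_cfc H id s
      rw [cfc_id ℝ H hH.isSelfAdjoint] at this
      simpa [hs] using this
    rw [Matrix.trace_mul_comm, ← Matrix.mul_assoc, this]
    simp
  · intro h
    refine ⟨cfc (fun t : ℝ => t⁻¹) H * ρ, ?_⟩
    have h1 : ∀ s : eigs H, eigProj H s * ρ = cfc (fun t : ℝ => t * t⁻¹) H * eigProj H s * ρ := by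
      intro s
      rw [cfc_mul_eigProj]
      by_cases hs : (s : ℝ) = 0
      · have := mul_eq_zero_of_trace_re_eq_zero hρ (eigProj_posSemidef H s) (h s hs)
        have h2 : eigProj H s * ρ = 0 := by
          have h3 := congrArg Matrix.conjTranspose this
          rwa [Matrix.conjTranspose_mul, hρ.1.eq, (eigProj_posSemidef H s).1.eq,
            Matrix.conjTranspose_zero] at h3
        rw [Matrix.smul_mul, h2]; simp
      · simp [mul_inv_cancel₀ hs]
    rw [← Matrix.mul_assoc, mul_cfc hH]
    calc ρ = ∑ s : eigs H, eigProj H s * ρ := by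
          rw [← Matrix.sum_mul, sum_eigProj hH, Matrix.one_mul]
      _ = ∑ s : eigs H, cfc (fun t : ℝ => t * t⁻¹) H * eigProj H s * ρ :=
          Finset.sum_congr rfl fun s _ => h1 s
      _ = _ := by rw [← Matrix.sum_mul, ← Matrix.mul_sum, sum_eigProj hH, Matrix.mul_one]

/-! ### Scalar inequalities -/

/-- If the Stieltjes transforms of two measures of equal mass are comparable, then so are the
integrals of the logarithm. -/
theorem sum_mul_log_le_of_resolvent_le {q s : ι → ℝ} {p t : κ → ℝ} (hs : ∀ i, 0 ≤ s i)
    (ht : ∀ j, 0 ≤ t j) (hqp : ∑ i, q i = ∑ j, p j)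
    (h : ∀ r > 0, ∑ j, p j / (t j + r) ≤ ∑ i, q i / (s i + r)) {ε : ℝ} (hε : 0 < ε) :
    ∑ i, q i * Real.log (s i + ε) ≤ ∑ j, p j * Real.log (t j + ε) := by
  -- The derivative of g is the difference of the Stieltjes transforms, so g decreases to its limit
  -- 0 at infinity and is non-negative at ε.
  let g : ℝ → ℝ := fun r => ∑ j, p j * Real.log (t j + r) - ∑ i, q i * Real.log (s i + r)
  have hd : ∀ r > 0, HasDerivAt g (∑ j, p j / (t j + r) - ∑ i, q i / (s i + r)) r := by
    intro r hr
    have aux : ∀ u v : ℝ, 0 ≤ v → HasDerivAt (fun r => u * Real.log (v + r)) (u / (v + r)) r := by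
      intro u v hv
      have := (((hasDerivAt_id r).const_add v).log (by simp; positivity)).const_mul u
      simpa [div_eq_mul_inv] using this
    exact (HasDerivAt.fun_sum fun j _ => aux (p j) (t j) (ht j)).sub
      (HasDerivAt.fun_sum fun i _ => aux (q i) (s i) (hs i))
  have hanti : AntitoneOn g (Set.Ioi 0) := by
    refine antitoneOn_of_deriv_nonpos (convex_Ioi 0)
      (fun r hr => (hd r hr).continuousAt.continuousWithinAt) ?_ ?_
    · exact fun r hr => (hd r (by simpa using hr)).differentiableAt.differentiableWithinAt
    · intro r hr
      have hr : 0 < r := by simpa using hr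
      rw [(hd r hr).deriv]
      linarith [h r hr]
  have hlim : Tendsto g atTop (nhds 0) := by
    have aux : ∀ v : ℝ, Tendsto (fun r => Real.log (v + r) - Real.log r) atTop (nhds 0) := by
      intro v
      have h1 : Tendsto (fun r : ℝ => v / r + 1) atTop (nhds 1) := by
        simpa using (tendsto_const_nhds (x := v)).div_atTop tendsto_id |>.add_const 1
      have h2 := (Real.continuousAt_log one_ne_zero).tendsto.comp h1
      rw [Real.log_one] at h2
      refine h2.congr' ?_
      filter_upwards [eventually_gt_atTop 0, eventually_gt_atTop (-v)] with r hr hr'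
      rw [← Real.log_div (by linarith) hr.ne', Function.comp_apply, add_div, div_self hr.ne']
    -- Equal total masses allow log r to be subtracted from every logarithm.
    have h1 : g = fun r => ∑ j, p j * (Real.log (t j + r) - Real.log r)
        - ∑ i, q i * (Real.log (s i + r) - Real.log r) := by
      ext r
      simp only [g, mul_sub, Finset.sum_sub_distrib, ← Finset.sum_mul, hqp]
      ring
    rw [h1]
    have h2 := (tendsto_finsetSum Finset.univ fun j _ => (aux (t j)).const_mul (p j)).sub
      (tendsto_finsetSum Finset.univ fun i _ => (aux (s i)).const_mul (q i))
    simpa using h2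
  have : 0 ≤ g ε := by
    refine le_of_tendsto hlim ?_
    filter_upwards [eventually_ge_atTop ε] with r hr
    exact hanti hε (hε.trans_le hr) hr
  simpa [g] using this

/-- A lower bound on `∑ p log (t + ε)` which is uniform in `ε` forces `p` to vanish where `t`
does, and passes to the limit. -/
theorem le_sum_mul_log_of_forall_add {p t : ι → ℝ} (hp : ∀ i, 0 ≤ p i) (ht : ∀ i, 0 ≤ t i)
    {C : ℝ} (h : ∀ ε > 0, C ≤ ∑ i, p i * Real.log (t i + ε)) :
    (∀ i, t i = 0 → p i = 0) ∧ C ≤ ∑ i, p i * Real.log (t i) := by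
  classical
  have h0 : ∀ i, t i = 0 → p i = 0 := by
    intro i hi
    by_contra hne
    have hpos : 0 < p i := lt_of_le_of_ne (hp i) (Ne.symm hne)
    -- For ε < 1 the other terms are bounded above by their values at ε = 1, so one atom at zero
    -- would drive the sum to −∞.
    have hlim : Tendsto (fun ε : ℝ => p i * Real.log ε
        + ∑ j ∈ Finset.univ.erase i, p j * Real.log (t j + 1)) (nhdsWithin 0 (Set.Ioi 0)) atBot :=
      tendsto_atBot_add_const_right _ _
        (Real.tendsto_log_nhdsGT_zero.const_mul_atBot hpos)
    have h1 := hlim.eventually (eventually_lt_atBot C)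
    have h2 : ∀ᶠ ε : ℝ in nhdsWithin 0 (Set.Ioi 0), ε ∈ Set.Ioo (0 : ℝ) 1 :=
      Ioo_mem_nhdsGT one_pos
    obtain ⟨ε, hε, hε0, hε1⟩ := (h1.and h2).exists
    refine absurd (h ε hε0) (not_le.mpr (lt_of_le_of_lt ?_ hε))
    rw [← Finset.add_sum_erase _ _ (Finset.mem_univ i), hi, zero_add]
    gcongr with j hj
    · exact hp j
    · linarith [ht j]
  refine ⟨h0, ge_of_tendsto (f := fun ε : ℝ => ∑ i, p i * Real.log (t i + ε))
    (x := nhdsWithin 0 (Set.Ioi 0)) ?_ ?_⟩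
  · refine tendsto_finsetSum _ fun i _ => ?_
    by_cases hi : t i = 0
    · simp [h0 i hi]
    · have : ContinuousAt (fun ε : ℝ => p i * Real.log (t i + ε)) 0 := by
        have : t i + 0 ≠ 0 := by simpa using hi
        fun_prop (disch := assumption)
      simpa using this.tendsto.mono_left nhdsWithin_le_nhds
  · filter_upwards [self_mem_nhdsWithin] with ε hε
    exact h ε hε

/-! ### Operator inequalities for the logarithm -/

theorem posSemidef_sum_smul {p : ι → ℝ} (hp : ∀ i, 0 ≤ p i) {d : Type*} {X : ι → Op d}
    (hX : ∀ i, (X i).PosSemidef) : (∑ i, (p i : ℂ) • X i).PosSemidef :=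
  Matrix.posSemidef_sum _ fun i _ => (hX i).smul (by exact_mod_cast hp i)

/-- A positive unital map `Φ` with `Φ A ≤ c B` satisfies the corresponding inequality for
resolvents, with the order reversed. -/
theorem resolvent_le_map_resolvent {Φ : Op b →ₗ[ℂ] Op a} (hΦ : IsPositiveMap Φ) (hΦ1 : Φ 1 = 1)
    {A : Op b} (hA : A.PosSemidef) {B : Op a} (hB : B.PosSemidef) {c : ℝ} (hc : 0 < c)
    (hAB : ((c : ℂ) • B - Φ A).PosSemidef) {r : ℝ} (hr : 0 < r) :
    (∑ s : eigs A, (((s / c + r)⁻¹ : ℝ) : ℂ) • Φ (eigProj A s)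
      - cfc (fun t : ℝ => (t + r)⁻¹) B).PosSemidef := by
  set T := cfc (fun t : ℝ => (t + r)⁻¹) B with hT
  have hTH : Tᴴ = T := cfc_isHermitian _ _
  have hs : ∀ s : eigs A, 0 < (s : ℝ) / c + r := fun s => by
    have := eigs_nonneg hA s
    positivity
  have hBT : (B + (r : ℂ) • 1) * T = 1 := by
    have h1 : B + (r : ℂ) • (1 : Op a) = cfc (fun t : ℝ => t + r) B := by
      rw [cfc_add_const r (fun t => t) B (continuousOn_spectrum _ _) hB.1.isSelfAdjoint,
        cfc_id' ℝ B hB.1.isSelfAdjoint]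
      congr 1
      ext i j
      simp [Matrix.algebraMap_matrix_apply, Matrix.one_apply]
    rw [h1, hT, ← cfc_mul _ _ _ (continuousOn_spectrum _ _) (continuousOn_spectrum _ _),
      ← cfc_const_one ℝ B hB.1.isSelfAdjoint]
    refine cfc_congr fun t ht => ?_
    have : 0 ≤ t := spectrum_nonneg_of_nonneg hB.nonneg ht
    exact mul_inv_cancel₀ (by positivity)
  -- A completed square: with λ_s = s/c + r and P_s the spectral projectors of A, the sum of λ_s
  -- (λ_s⁻¹ − T) Φ(P_s) (λ_s⁻¹ − T) is Σ λ_s⁻¹ Φ(P_s) − 2T + T(Φ(A)/c + r)T. Each summand needs only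
  -- positivity of Φ.
  have h1 : (∑ s : eigs A, (((s : ℝ) / c + r : ℝ) : ℂ) •
      ((((((s : ℝ) / c + r)⁻¹ : ℝ) : ℂ) • 1 - T) * Φ (eigProj A s)
        * (((((s : ℝ) / c + r)⁻¹ : ℝ) : ℂ) • 1 - T))).PosSemidef := by
    refine posSemidef_sum_smul (fun s => (hs s).le) fun s => ?_
    have := (hΦ _ (eigProj_posSemidef A s)).mul_mul_conjTranspose_same
      (((((s : ℝ) / c + r)⁻¹ : ℝ) : ℂ) • 1 - T)
    simpa [hTH] using this
  have hsum : ∑ s : eigs A, Φ (eigProj A s) = 1 := by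
    rw [← map_sum, sum_eigProj hA.1, hΦ1]
  have hsumA : ∑ s : eigs A, (((s : ℝ) / c + r : ℝ) : ℂ) • Φ (eigProj A s)
      = (c : ℂ)⁻¹ • Φ A + (r : ℂ) • 1 := by
    conv_rhs => rw [eq_sum_eigProj hA.1, ← hsum]
    simp only [map_sum, map_smul, Finset.smul_sum, smul_smul, ← Finset.sum_add_distrib, ← add_smul]
    refine Finset.sum_congr rfl fun s _ => ?_
    congr 1
    push_cast
    ring
  have h2 : ∑ s : eigs A, (((s : ℝ) / c + r : ℝ) : ℂ) •
      ((((((s : ℝ) / c + r)⁻¹ : ℝ) : ℂ) • 1 - T) * Φ (eigProj A s)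
        * (((((s : ℝ) / c + r)⁻¹ : ℝ) : ℂ) • 1 - T))
      = ∑ s : eigs A, ((((s : ℝ) / c + r)⁻¹ : ℝ) : ℂ) • Φ (eigProj A s) - T - T
        + T * ((c : ℂ)⁻¹ • Φ A + (r : ℂ) • 1) * T := by
    rw [← hsumA, Matrix.mul_sum, Matrix.sum_mul]
    have h3 : T = ∑ s : eigs A, T * Φ (eigProj A s) := by
      rw [← Matrix.mul_sum, hsum, Matrix.mul_one]
    have h4 : T = ∑ s : eigs A, Φ (eigProj A s) * T := by
      rw [← Matrix.sum_mul, hsum, Matrix.one_mul]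
    conv_rhs => enter [1, 1, 2]; rw [h3]
    conv_rhs => enter [1, 2]; rw [h4]
    rw [← Finset.sum_sub_distrib, ← Finset.sum_sub_distrib, ← Finset.sum_add_distrib]
    refine Finset.sum_congr rfl fun s _ => ?_
    have hne : (((s : ℝ) / c + r : ℝ) : ℂ) ≠ 0 := by exact_mod_cast (hs s).ne'
    simp only [Matrix.sub_mul, Matrix.mul_sub, Matrix.smul_mul, Matrix.mul_smul, Matrix.one_mul,
      Matrix.mul_one, smul_sub, smul_smul, Complex.ofReal_inv, mul_inv_cancel₀ hne, one_smul,
      mul_inv_cancel_left₀ hne]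
    abel
  -- This replaces Φ(A)/c by B in the quadratic term, which then becomes T(B + r)T = T and cancels
  -- one of the two copies of −T.
  have h3 := (hAB.conjTranspose_mul_mul_same T).smul (a := ((c⁻¹ : ℝ) : ℂ))
    (by exact_mod_cast (inv_pos.mpr hc).le)
  have h4 : T = T * (B + (r : ℂ) • 1) * T := by rw [Matrix.mul_assoc, hBT, Matrix.mul_one]
  have hcne : (c : ℂ) ≠ 0 := by exact_mod_cast hc.ne'
  convert h1.add h3 using 1
  rw [h2, hTH]
  conv_lhs => rw [← sub_add_cancel (_ - T) T]
  conv_lhs => enter [2]; rw [h4]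
  simp only [Matrix.mul_sub, Matrix.sub_mul, Matrix.mul_add, Matrix.add_mul, Matrix.smul_mul,
    Matrix.mul_smul, smul_sub, smul_smul, Complex.ofReal_inv, inv_mul_cancel₀ hcne, one_smul]
  abel

/-- Operator Jensen inequality for the logarithm, combined with its operator monotonicity, under a
trace and with supports taken into account: `Φ` is positive and unital, and `ρ'` is the image of
the state `ρ` under the adjoint of `Φ`. -/
theorem trace_mul_mlog_le {Φ : Op b →ₗ[ℂ] Op a} (hΦ : IsPositiveMap Φ) (hΦ1 : Φ 1 = 1)
    {A : Op b} (hA : A.PosSemidef) {B : Op a} (hB : B.PosSemidef) {c : ℝ} (hc : 0 < c)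
    (hAB : ((c : ℂ) • B - Φ A).PosSemidef) {ρ : Op a} (hρ : IsState ρ) {ρ' : Op b}
    (hρ' : ρ'.PosSemidef) (hρρ' : ∀ K, (ρ' * K).trace = (ρ * Φ K).trace)
    (hsupp : supp ρ' ≤ supp A) :
    supp ρ ≤ supp B ∧
      (ρ' * mlog A).trace.re - Real.log c ≤ (ρ * mlog B).trace.re := by
  rw [supp_le_supp_iff_trace hρ' hA.1] at hsupp
  rw [supp_le_supp_iff_trace hρ.1 hB.1]
  set q : eigs A → ℝ := fun s => (ρ' * eigProj A s).trace.re with hq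
  set p : eigs B → ℝ := fun t => (ρ * eigProj B t).trace.re with hp
  have hρ1 : ρ.trace.re = 1 := by simp [hρ.2]
  have hρ'1 : ρ'.trace.re = 1 := by
    have := hρρ' 1
    rw [hΦ1, Matrix.mul_one, Matrix.mul_one] at this
    rw [this, hρ1]
  have hq0 : ∀ s, 0 ≤ q s := fun s => trace_mul_re_nonneg hρ' (eigProj_posSemidef A s)
  have hp0 : ∀ s, 0 ≤ p s := fun s => trace_mul_re_nonneg hρ.1 (eigProj_posSemidef B s)
  have hq1 : ∑ s, q s = 1 := by rw [← hρ'1]; exact sum_trace_mul_eigProj ρ' hA.1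
  have hp1 : ∑ s, p s = 1 := by rw [← hρ1]; exact sum_trace_mul_eigProj ρ hB.1
  have hkey : ∀ ε > 0, ∑ s : eigs A, q s * Real.log (s / c + ε)
      ≤ ∑ t : eigs B, p t * Real.log (t + ε) := by
    intro ε hε
    refine sum_mul_log_le_of_resolvent_le (s := fun s : eigs A => (s : ℝ) / c)
      (t := fun t : eigs B => (t : ℝ)) (fun s => div_nonneg (eigs_nonneg hA s) hc.le)
      (eigs_nonneg hB) (hq1.trans hp1.symm) (fun r hr => ?_) hε
    have := trace_re_mono hρ.1 (resolvent_le_map_resolvent hΦ hΦ1 hA hB hc hAB hr)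
    rw [trace_mul_cfc] at this
    convert this using 1
    · exact Finset.sum_congr rfl fun t _ => by rw [div_eq_inv_mul]
    · simp only [Matrix.mul_sum, Matrix.trace_sum, Matrix.mul_smul, Matrix.trace_smul, smul_eq_mul,
        Complex.re_sum, Complex.re_ofReal_mul, hq, hρρ', div_eq_inv_mul]
  -- The constant C may include s = 0, where `Real.log 0 = 0`: the support hypothesis on ρ' gives q
  -- s = 0 there.
  have := le_sum_mul_log_of_forall_add (t := fun t : eigs B => (t : ℝ)) hp0 (eigs_nonneg hB)
    (C := ∑ s : eigs A, q s * (Real.log s - Real.log c)) fun ε hε => ?_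
  · refine ⟨this.1, ?_⟩
    have h := this.2
    simp only [mul_sub, Finset.sum_sub_distrib, ← Finset.sum_mul, hq1, one_mul] at h
    rw [mlog, mlog, trace_mul_cfc, trace_mul_cfc]
    simpa [mul_comm] using h
  · refine le_trans (Finset.sum_le_sum fun s _ => ?_) (hkey ε hε)
    rcases eq_or_lt_of_le (eigs_nonneg hA s) with h0 | h0
    · simp [hq, hsupp s h0.symm]
    · rw [← Real.log_div h0.ne' hc.ne']
      refine mul_le_mul_of_nonneg_left (Real.log_le_log (by positivity) ?_) (hq0 s)
      linarith

/-- Klein's inequality. -/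
theorem trace_mul_mlog_le_trace_mul_mlog_self {ρ W : Op a} (hρ : IsState ρ) (hW : W.PosSemidef)
    (hW1 : W.trace.re ≤ 1) (hsupp : supp ρ ≤ supp W) :
    (ρ * mlog W).trace.re ≤ (ρ * mlog ρ).trace.re := by
  rw [supp_le_supp_iff_trace hρ.1 hW.1] at hsupp
  -- The overlaps k r w form a non-negative array with the eigenspace dimensions as marginals,
  -- reducing the claim to a scalar inequality for each pair of eigenvalues.
  set k : eigs ρ → eigs W → ℝ := fun r w => (eigProj ρ r * eigProj W w).trace.re with hk
  have hk0 : ∀ r w, 0 ≤ k r w := fun r w =>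
    trace_mul_re_nonneg (eigProj_posSemidef _ _) (eigProj_posSemidef _ _)
  have hkr : ∀ r, ∑ w, k r w = (eigProj ρ r).trace.re := fun r => sum_trace_mul_eigProj _ hW.1
  have hkw : ∀ w, ∑ r, k r w = (eigProj W w).trace.re := fun w => by
    rw [← sum_trace_mul_eigProj _ hρ.1.1]
    exact Finset.sum_congr rfl fun r _ => by rw [hk, Matrix.trace_mul_comm]
  have hρw : ∀ w : eigs W, (ρ * eigProj W w).trace.re = ∑ r : eigs ρ, r * k r w := fun w => by
    conv_lhs => rw [eq_sum_eigProj hρ.1.1]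
    simp only [Matrix.sum_mul, Matrix.trace_sum, hk, Matrix.smul_mul, Matrix.trace_smul,
      smul_eq_mul, Complex.re_sum, Complex.re_ofReal_mul]
  have htr : ∀ {H : Op a}, H.IsHermitian → ∀ f : ℝ → ℝ, (cfc f H).trace.re
      = ∑ s : eigs H, f s * (eigProj H s).trace.re := fun _ f => by
    simp [cfc_eq_sum_eigProj, Matrix.trace_sum]
  have hρlog : (ρ * mlog ρ).trace.re = ∑ r : eigs ρ, (r * Real.log r) * ∑ w, k r w := by
    have h1 : ρ * mlog ρ = cfc (fun t : ℝ => t * Real.log t) ρ := by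
      rw [cfc_mul _ _ _ (continuousOn_spectrum _ _) (continuousOn_spectrum _ _),
        cfc_id' ℝ ρ hρ.1.1.isSelfAdjoint]
      rfl
    rw [h1, htr hρ.1.1]
    simp only [hkr]
  have hρ1 : ∑ r : eigs ρ, (r : ℝ) * ∑ w, k r w = 1 := by
    have := htr hρ.1.1 id
    rw [cfc_id ℝ ρ hρ.1.1.isSelfAdjoint, hρ.2] at this
    simp only [hkr]
    exact this.symm
  have hWt : ∑ w : eigs W, (w : ℝ) * ∑ r, k r w ≤ 1 := by
    have := htr hW.1 id
    rw [cfc_id ℝ W hW.1.isSelfAdjoint] at this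
    simp only [hkw]
    exact this.symm.le.trans hW1
  -- This is r − w ≤ r log r − r log w, from log x ≤ x − 1 at x = w/r. At w = 0 the support
  -- hypothesis kills r · k r w. Summed, the left side is tr ρ − tr W ≥ 0.
  have hpt : ∀ (w : eigs W) (r : eigs ρ), k r w * (r - w) ≤
      k r w * (r * Real.log r) - k r w * (r * Real.log w) := by
    intro w r
    have hr := eigs_nonneg hρ.1 r
    rcases eq_or_lt_of_le (eigs_nonneg hW w) with h0 | h0
    · have h1 := hsupp w h0.symm
      rw [hρw, Finset.sum_eq_zero_iff_of_nonneg
        fun r _ => mul_nonneg (eigs_nonneg hρ.1 r) (hk0 r w)] at h1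
      have h2 := h1 r (Finset.mem_univ r)
      rcases mul_eq_zero.mp h2 with h3 | h3
      · simp [h3, ← h0]
      · simp [h3]
    · rw [← mul_sub]
      refine mul_le_mul_of_nonneg_left ?_ (hk0 r w)
      rcases eq_or_lt_of_le hr with h3 | h3
      · simp [← h3, h0.le]
      · have h4 := Real.log_le_sub_one_of_pos (div_pos h0 h3)
        rw [Real.log_div h0.ne' h3.ne'] at h4
        have h5 := mul_le_mul_of_nonneg_left h4 hr
        have h6 : (r : ℝ) * (w / r - 1) = w - r := by field_simp
        rw [h6] at h5
        linarith
  have hsum := Finset.sum_le_sum fun w (_ : w ∈ Finset.univ) =>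
    Finset.sum_le_sum fun r (_ : r ∈ Finset.univ) => hpt w r
  rw [hρlog, mlog, trace_mul_cfc]
  simp only [hρw, Finset.mul_sum] at hρ1 hWt ⊢
  rw [Finset.sum_comm] at hρ1
  rw [Finset.sum_comm (s := (Finset.univ : Finset (eigs ρ)))]
  simp only [mul_sub, Finset.sum_sub_distrib] at hsum
  have e1 : ∑ w : eigs W, ∑ r : eigs ρ, k r w * (r : ℝ) = 1 := by
    rw [← hρ1]; simp only [mul_comm]
  have e2 : ∑ w : eigs W, ∑ r : eigs ρ, k r w * (w : ℝ) ≤ 1 := by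
    refine le_trans (le_of_eq ?_) hWt; simp only [mul_comm]
  have e3 : ∑ w : eigs W, ∑ r : eigs ρ, k r w * ((r : ℝ) * Real.log r)
      = ∑ w : eigs W, ∑ r : eigs ρ, (r : ℝ) * Real.log r * k r w := by simp only [mul_comm]
  have e4 : ∑ w : eigs W, ∑ r : eigs ρ, k r w * ((r : ℝ) * Real.log w)
      = ∑ w : eigs W, ∑ r : eigs ρ, Real.log w * ((r : ℝ) * k r w) := by
    refine Finset.sum_congr rfl fun w _ => Finset.sum_congr rfl fun r _ => by ring
  linarith

/-- The logarithm of a product of commuting positive semidefinite matrices. -/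
theorem trace_mul_mlog_mul {ρ A B : Op a} (hρ : ρ.PosSemidef) (hA : A.PosSemidef)
    (hB : B.PosSemidef)
    (hAB : Commute A B) (hρA : supp ρ ≤ supp A) (hρB : supp ρ ≤ supp B) :
    supp ρ ≤ supp (A * B) ∧
      (ρ * mlog (A * B)).trace.re = (ρ * mlog A).trace.re + (ρ * mlog B).trace.re := by
  have hmul : A * B * (cfc (fun t : ℝ => t⁻¹) A * (cfc (fun t : ℝ => t⁻¹) B * ρ)) = ρ := by
    have h1 : B * cfc (fun t : ℝ => t⁻¹) A = cfc (fun t : ℝ => t⁻¹) A * B :=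
      (hAB.cfc_real _).symm.eq
    rw [Matrix.mul_assoc, ← Matrix.mul_assoc B, h1, Matrix.mul_assoc _ B, mul_cfc_inv_mul hB.1 hρB,
      mul_cfc_inv_mul hA.1 hρA]
  refine ⟨supp_le_supp_iff.mpr ⟨_, hmul.symm⟩, ?_⟩
  rw [supp_le_supp_iff_trace hρ hA.1] at hρA
  rw [supp_le_supp_iff_trace hρ hB.1] at hρB
  have hEB : ∀ s, B * eigProj A s = eigProj A s * B := fun s => (hAB.cfc_real _).symm.eq
  have hEF : ∀ s t, eigProj B t * eigProj A s = eigProj A s * eigProj B t := fun s t =>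
    (Commute.cfc_real (hEB s) _).eq
  have hAE : ∀ {H : Op a}, H.IsHermitian → ∀ s : ℝ, H * eigProj H s = (s : ℂ) • eigProj H s := by
    intro H hH s
    conv_lhs => enter [1]; rw [← cfc_fun_id hH]
    exact cfc_mul_eigProj H _ s
  -- Joint spectral projectors of the commuting pair diagonalize A, B and AB at once.
  let Q : eigs A × eigs B → Op a := fun x => eigProj A x.1 * eigProj B x.2
  have hQ : ∑ x, Q x = 1 := by
    rw [Fintype.sum_prod_type]
    simp only [Q, ← Matrix.mul_sum, sum_eigProj hB.1, Matrix.mul_one, sum_eigProj hA.1]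
  have hQA : ∀ x, A * Q x = (((x.1 : ℝ)) : ℂ) • Q x := fun x => by
    rw [← Matrix.mul_assoc, hAE hA.1, Matrix.smul_mul]
  have hQB : ∀ x, B * Q x = (((x.2 : ℝ)) : ℂ) • Q x := fun x => by
    rw [← Matrix.mul_assoc, hEB, Matrix.mul_assoc, hAE hB.1, Matrix.mul_smul]
  have hQAB : ∀ x, A * B * Q x = (((x.1 * x.2 : ℝ)) : ℂ) • Q x := fun x => by
    rw [Matrix.mul_assoc, hQB, Matrix.mul_smul, hQA, smul_smul, mul_comm]
    push_cast
    rfl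
  have hH : (A * B).IsHermitian := by
    rw [Matrix.IsHermitian, Matrix.conjTranspose_mul, hA.1.eq, hB.1.eq, hAB.eq]
  rw [mlog, mlog, mlog, cfc_eq_sum_smul hH hQ hQAB, cfc_eq_sum_smul hA.1 hQ hQA,
    cfc_eq_sum_smul hB.1 hQ hQB]
  simp only [Matrix.mul_sum, Matrix.trace_sum, Matrix.mul_smul, Matrix.trace_smul, smul_eq_mul,
    Complex.re_sum, Complex.re_ofReal_mul, ← Finset.sum_add_distrib, ← add_mul]
  refine Finset.sum_congr rfl fun x _ => ?_
  -- The logarithm of a product splits only for nonzero factors; ρ annihilates the remaining blocks.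
  by_cases h1 : (x.1 : ℝ) = 0
  · have : ρ * Q x = 0 := by
      rw [← Matrix.mul_assoc, mul_eq_zero_of_trace_re_eq_zero hρ (eigProj_posSemidef A _)
        (hρA _ h1), Matrix.zero_mul]
    simp [this]
  by_cases h2 : (x.2 : ℝ) = 0
  · have : ρ * Q x = 0 := by
      simp only [Q]
      rw [← hEF, ← Matrix.mul_assoc, mul_eq_zero_of_trace_re_eq_zero hρ (eigProj_posSemidef B _)
        (hρB _ h2), Matrix.zero_mul]
    simp [this]
  rw [Real.log_mul h1 h2]

variable {n : ℕ}

/-! ### Tensor products -/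

theorem tensor_mul {a : Type*} [Fintype a] (X Y : Fin n → Op a) :
    tensor X * tensor Y = tensor fun i => X i * Y i := by
  ext f g
  simp only [tensor, Matrix.mul_apply, Matrix.of_apply]
  rw [Finset.prod_univ_sum, Fintype.piFinset_univ]
  simp only [Finset.prod_mul_distrib]

theorem tensor_one {a : Type*} [DecidableEq a] : tensor (fun _ : Fin n => (1 : Op a)) = 1 := by
  ext f g
  simp only [tensor, Matrix.of_apply, Matrix.one_apply, Finset.prod_ite_zero, Finset.prod_const_one,
    funext_iff, Finset.mem_univ, true_imp_iff]

theorem conjTranspose_tensor {a : Type*} (X : Fin n → Op a) :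
    (tensor X)ᴴ = tensor fun i => (X i)ᴴ := by
  ext f g
  simp [tensor]

theorem trace_tensor {a : Type*} [Fintype a] (X : Fin n → Op a) :
    (tensor X).trace = ∏ i, (X i).trace := by
  simp only [tensor, Matrix.trace, Matrix.diag_apply, Matrix.of_apply]
  rw [Finset.prod_univ_sum, Fintype.piFinset_univ]

theorem tensor_smul {a : Type*} (c : Fin n → ℂ) (X : Fin n → Op a) :
    tensor (fun i => c i • X i) = (∏ i, c i) • tensor X := by
  ext f g
  simp [tensor, Finset.prod_mul_distrib]

theorem sum_tensor {a κ : Type*} [Fintype κ] (P : Fin n → κ → Op a) :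
    ∑ x : Fin n → κ, tensor (fun i => P i (x i)) = tensor fun i => ∑ k, P i k := by
  classical
  ext f g
  simp only [tensor, Matrix.sum_apply, Matrix.of_apply]
  rw [Finset.prod_univ_sum, Fintype.piFinset_univ]

theorem tensor_posSemidef {X : Fin n → Op a} (hX : ∀ i, (X i).PosSemidef) :
    (tensor X).PosSemidef := by
  choose C hC using fun i => (hX i).exists_eq_conjTranspose_mul_self
  have : tensor X = (tensor C)ᴴ * tensor C := by
    rw [conjTranspose_tensor, tensor_mul]
    exact congrArg tensor (funext hC)
  rw [this]
  exact Matrix.posSemidef_conjTranspose_mul_self _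

theorem tensor_single {a : Type*} [DecidableEq a] (f g : Fin n → a) :
    tensor (fun i => Matrix.single (f i) (g i) (1 : ℂ)) = Matrix.single f g 1 := by
  ext p q
  simp only [tensor, Matrix.of_apply, Matrix.single_apply, Finset.prod_ite_zero,
    Finset.prod_const_one, funext_iff, Finset.mem_univ, true_imp_iff, forall_and]

/-- Linear maps on a tensor power are determined by their values on product matrices. -/
theorem linearMap_ext_tensor {E : Type*} [AddCommMonoid E] [Module ℂ E]
    {L L' : Op (Fin n → a) →ₗ[ℂ] E} (h : ∀ X, L (tensor X) = L' (tensor X)) : L = L' := by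
  refine Matrix.ext_linearMap ℂ fun f g => LinearMap.ext_ring ?_
  simpa [tensor_single] using h fun i => Matrix.single (f i) (g i) 1

theorem tensorPow_mul {a : Type*} [Fintype a] (X Y : Op a) :
    tensorPow n X * tensorPow n Y = tensorPow n (X * Y) :=
  tensor_mul _ _

theorem tensorPow_posSemidef {X : Op a} (hX : X.PosSemidef) : (tensorPow n X).PosSemidef :=
  tensor_posSemidef fun _ => hX

theorem tensorPow_isState {ρ : Op a} (hρ : IsState ρ) : IsState (tensorPow n ρ) :=
  ⟨tensorPow_posSemidef hρ.1, by simp [tensorPow, trace_tensor, hρ.2]⟩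

theorem supp_tensorPow_le {X Y : Op a} (h : supp X ≤ supp Y) :
    supp (tensorPow n X) ≤ supp (tensorPow n Y) := by
  obtain ⟨M, rfl⟩ := supp_le_supp_iff.mp h
  exact supp_le_supp_iff.mpr ⟨tensorPow n M, (tensorPow_mul _ _).symm⟩

theorem tensorMap_tensorPow {b : Type*} (N : Op a →ₗ[ℂ] Op b) (X : Op a) :
    tensorMap n N (tensorPow n X) = tensorPow n (N X) :=
  tensorMap_tensor n N fun _ => X

theorem tensorMap_isTracePreserving {b : Type*} [Fintype b] {N : Op a →ₗ[ℂ] Op b}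
    (hN : IsTracePreserving N) :
    IsTracePreserving (tensorMap n N) := by
  have : (Matrix.traceLinearMap (Fin n → b) ℂ ℂ) ∘ₗ tensorMap n N
      = Matrix.traceLinearMap (Fin n → a) ℂ ℂ := linearMap_ext_tensor fun X => by
    simp [tensorMap_tensor, trace_tensor, hN _]
  exact fun X => LinearMap.congr_fun this X

theorem adjointMap_tensorMap (N : Op a →ₗ[ℂ] Op b) :
    adjointMap (tensorMap n N) = tensorMap n (adjointMap N) := linearMap_ext_tensor fun X => by
  rw [tensorMap_tensor]
  ext f g
  have : ((tensorMap n N (Matrix.single f g 1))ᴴ * tensor X).trace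
      = ∏ i, ((N (Matrix.single (f i) (g i) 1))ᴴ * X i).trace := by
    rw [← tensor_single, tensorMap_tensor, conjTranspose_tensor, tensor_mul, trace_tensor]
  exact this

/-- This form exposes the adjoint of N^{⊗n}, whose positivity follows from that of N^{⊗n}. -/
theorem tensorMap_petz (σ : Op a) (N : Op a →ₗ[ℂ] Op b) (X : Op (Fin n → b)) :
    tensorMap n (petz σ N) X = tensorPow n (msqrt σ) * adjointMap (tensorMap n N)
      (tensorPow n (minvSqrt (N σ)) * X * tensorPow n (minvSqrt (N σ))) *
        tensorPow n (msqrt σ) := by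
  let L : Op (Fin n → b) →ₗ[ℂ] Op (Fin n → a) :=
    LinearMap.mulLeftRight ℂ (tensorPow n (msqrt σ), tensorPow n (msqrt σ)) ∘ₗ
      adjointMap (tensorMap n N) ∘ₗ
      LinearMap.mulLeftRight ℂ (tensorPow n (minvSqrt (N σ)), tensorPow n (minvSqrt (N σ)))
  have : tensorMap n (petz σ N) = L := linearMap_ext_tensor fun X => by
    simp only [L, LinearMap.comp_apply, LinearMap.mulLeftRight_apply, adjointMap_tensorMap,
      tensorPow, tensor_mul, tensorMap_tensor]
    rfl
  simpa [L] using LinearMap.congr_fun this X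

/-- The trace of a product state against the logarithm of a product matrix is additive. -/
theorem trace_tensorPow_mul_mlog {ρ A : Op a} (hρ : IsState ρ) (hA : A.PosSemidef)
    (hsupp : supp ρ ≤ supp A) :
    (tensorPow n ρ * mlog (tensorPow n A)).trace.re = n * (ρ * mlog A).trace.re := by
  rw [supp_le_supp_iff_trace hρ.1 hA.1] at hsupp
  let Q : (Fin n → eigs A) → Op (Fin n → a) := fun x => tensor fun i => eigProj A (x i)
  have hQ : ∑ x, Q x = 1 := by
    simp only [Q]
    rw [sum_tensor fun _ (s : eigs A) => eigProj A s]
    simp only [sum_eigProj hA.1, tensor_one]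
  have hQA : ∀ x, tensorPow n A * Q x = ((∏ i, (x i : ℝ) : ℝ) : ℂ) • Q x := fun x => by
    simp only [Q]
    rw [tensorPow, tensor_mul]
    have h1 : ∀ s : ℝ, A * eigProj A s = (s : ℂ) • eigProj A s := fun s => by
      conv_lhs => enter [1]; rw [← cfc_fun_id hA.1]
      exact cfc_mul_eigProj A _ s
    simp only [h1]
    rw [tensor_smul]
    push_cast
    rfl
  have hreal : ∀ s : ℝ, (ρ * eigProj A s).trace = ((ρ * eigProj A s).trace.re : ℂ) := fun s =>
    Complex.ext rfl (Complex.le_def.mp (trace_mul_nonneg hρ.1 (eigProj_posSemidef A s))).2.symm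
  have hρQ : ∀ x, (tensorPow n ρ * Q x).trace.re = ∏ i, (ρ * eigProj A (x i)).trace.re := by
    intro x
    simp only [Q]
    rw [tensorPow, tensor_mul, trace_tensor]
    rw [Finset.prod_congr rfl fun i _ => hreal (x i), ← Complex.ofReal_prod, Complex.ofReal_re]
  have hsum : ∑ s : eigs A, (ρ * eigProj A s).trace.re = 1 := by
    rw [sum_trace_mul_eigProj ρ hA.1, hρ.2, Complex.one_re]
  rw [mlog, mlog, cfc_eq_sum_smul (tensorPow_posSemidef hA).1 hQ hQA, trace_mul_cfc]
  simp only [Matrix.mul_sum, Matrix.trace_sum, Matrix.mul_smul, Matrix.trace_smul, smul_eq_mul,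
    Complex.re_sum, Complex.re_ofReal_mul, hρQ]
  -- The spectral weights form a product probability distribution: the log of the product is a sum
  -- over sites, and for each site the other factors sum to 1. Sequences containing a zero
  -- eigenvalue carry no weight.
  have h2 : ∀ x : Fin n → eigs A,
      Real.log (∏ i, (x i : ℝ)) * ∏ i, (ρ * eigProj A (x i)).trace.re
      = ∑ j, ∏ i, (if i = j then Real.log (x i) else 1) * (ρ * eigProj A (x i)).trace.re := by
    intro x
    by_cases hx : ∀ i, (x i : ℝ) ≠ 0
    · rw [Real.log_prod fun i _ => hx i, Finset.sum_mul]
      refine Finset.sum_congr rfl fun j _ => ?_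
      rw [Finset.prod_mul_distrib, Finset.prod_ite_eq' Finset.univ j]
      simp
    · push Not at hx
      obtain ⟨i, hi⟩ := hx
      have h3 := hsupp _ hi
      rw [Finset.prod_eq_zero (f := fun i => (ρ * eigProj A (x i)).trace.re) (Finset.mem_univ i) h3,
        mul_zero]
      refine (Finset.sum_eq_zero fun j _ => ?_).symm
      exact Finset.prod_eq_zero (Finset.mem_univ i) (by rw [h3, mul_zero])
  simp only [h2]
  rw [Finset.sum_comm]
  have h4 : ∀ j : Fin n, ∑ x : Fin n → eigs A,
      ∏ i, (if i = j then Real.log (x i) else 1) * (ρ * eigProj A (x i)).trace.re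
      = ∑ s : eigs A, Real.log s * (ρ * eigProj A s).trace.re := by
    intro j
    have h5 := Finset.prod_univ_sum (fun _ : Fin n => (Finset.univ : Finset (eigs A)))
      fun i s => (if i = j then Real.log s else 1) * (ρ * eigProj A s).trace.re
    rw [Fintype.piFinset_univ] at h5
    rw [← h5, ← Finset.mul_prod_erase _ _ (Finset.mem_univ j)]
    rw [Finset.prod_eq_one fun i hi => ?_, mul_one]
    · simp
    · simp only [if_neg (Finset.ne_of_mem_erase hi), one_mul, hsum]
  rw [Finset.sum_congr rfl fun j _ => h4 j, Finset.sum_const, Finset.card_univ, Fintype.card_fin,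
    nsmul_eq_mul]

/-! ### Pinching -/

theorem tensor_eigProj_mul (H : Op a) (x y : Fin n → eigs H) :
    tensor (fun i => eigProj H (x i)) * tensor (fun i => eigProj H (y i))
      = if x = y then tensor (fun i => eigProj H (x i)) else 0 := by
  rw [tensor_mul]
  split_ifs with h
  · subst h
    simp [eigProj_mul_eigProj]
  · obtain ⟨i, hi⟩ := Function.ne_iff.mp h
    have : eigProj H (x i) * eigProj H (y i) = 0 := by
      rw [eigProj_mul_eigProj, if_neg fun h => hi (Subtype.ext h.symm)]
    ext f g
    simp only [tensor, Matrix.of_apply, Matrix.zero_apply]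
    exact Finset.prod_eq_zero (Finset.mem_univ i) (by rw [this]; rfl)

theorem typeProj_posSemidef (n : ℕ) (H : Op a) (l : eigs H → ℕ) : (typeProj n H l).PosSemidef :=
  Matrix.posSemidef_sum _ fun _ _ => tensor_posSemidef fun _ => eigProj_posSemidef _ _

theorem typeProj_mul_self (n : ℕ) (H : Op a) (l : eigs H → ℕ) :
    typeProj n H l * typeProj n H l = typeProj n H l := by
  simp only [typeProj, Matrix.sum_mul, Matrix.mul_sum, tensor_eigProj_mul]
  refine Finset.sum_congr rfl fun x hx => ?_
  rw [Finset.sum_ite_eq', if_pos hx]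

theorem sum_typeProj (n : ℕ) {H : Op a} (hH : H.IsHermitian) :
    ∑ l ∈ types n H, typeProj n H l = 1 := by
  have h1 : ∑ x : Fin n → eigs H, tensor (fun i => eigProj H (x i)) = 1 := by
    rw [sum_tensor fun _ (s : eigs H) => eigProj H s]
    simp only [sum_eigProj hH, tensor_one]
  rw [← h1, ← Finset.sum_fiberwise_of_maps_to (t := types n H)
    (g := fun (x : Fin n → eigs H) y => (Finset.univ.filter fun i => x i = y).card)]
  · simp only [typeProj, funext_iff]
  · intro x _
    simp only [types, Finset.mem_piAntidiag, Finset.mem_univ, implies_true, and_true]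
    rw [← Finset.card_eq_sum_card_fiberwise fun i _ => Finset.mem_univ (x i)]
    simp

/-- Each multiplicity lies in 0, …, n. This polynomial count is what makes the pinching cost vanish
after division by n. -/
theorem card_types_le (n : ℕ) (H : Op a) : (types n H).card ≤ (n + 1) ^ (eigs H).card := by
  have : types n H ⊆ Fintype.piFinset fun _ => Finset.range (n + 1) := by
    intro l hl
    simp only [types, Finset.mem_piAntidiag] at hl
    refine Fintype.mem_piFinset.mpr fun s => Finset.mem_range_succ_iff.mpr ?_
    rw [← hl.1]
    exact Finset.single_le_sum (fun _ _ => Nat.zero_le _) (Finset.mem_univ s)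
  simpa using Finset.card_le_card this

/-- On a product of eigenspaces the eigenvalue depends only on how often each eigenvalue occurs, so
it is constant on a type class. Hence pinched operators commute with tensor powers of every function
of H. -/
theorem tensorPow_cfc_mul_typeProj (f : ℝ → ℝ) (H : Op a) (l : eigs H → ℕ) :
    tensorPow n (cfc f H) * typeProj n H l = (∏ y : eigs H, (f y : ℂ) ^ l y) • typeProj n H l := by
  rw [typeProj, Matrix.mul_sum, Finset.smul_sum]
  refine Finset.sum_congr rfl fun x hx => ?_
  rw [tensorPow, tensor_mul]
  simp only [cfc_mul_eigProj]
  rw [tensor_smul, ← Finset.prod_fiberwise' Finset.univ x fun y : eigs H => (f y : ℂ)]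
  simp only [Finset.prod_const, (Finset.mem_filter.mp hx).2]

theorem tensorPow_cfc_isHermitian (f : ℝ → ℝ) (H : Op a) :
    (tensorPow n (cfc f H)).IsHermitian := by
  rw [Matrix.IsHermitian, tensorPow, conjTranspose_tensor, (cfc_isHermitian f H).eq]

theorem typeProj_mul_tensorPow_cfc (f : ℝ → ℝ) (H : Op a) (l : eigs H → ℕ) :
    typeProj n H l * tensorPow n (cfc f H) = (∏ y : eigs H, (f y : ℂ) ^ l y) • typeProj n H l := by
  have := congrArg Matrix.conjTranspose (tensorPow_cfc_mul_typeProj (n := n) f H l)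
  rw [Matrix.conjTranspose_mul, Matrix.conjTranspose_smul, (typeProj_posSemidef n H l).1.eq,
    (tensorPow_cfc_isHermitian f H).eq] at this
  simpa using this

theorem pinching_apply (n : ℕ) (H : Op a) (K : Op (Fin n → a)) :
    pinching n H K = ∑ l ∈ types n H, typeProj n H l * K * typeProj n H l := rfl

theorem tensorPow_cfc_mul_pinching (f : ℝ → ℝ) (H : Op a) (K : Op (Fin n → a)) :
    tensorPow n (cfc f H) * pinching n H K = pinching n H (tensorPow n (cfc f H) * K) := by
  rw [pinching_apply, pinching_apply, Matrix.mul_sum]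
  refine Finset.sum_congr rfl fun l _ => ?_
  simp only [← Matrix.mul_assoc, tensorPow_cfc_mul_typeProj, typeProj_mul_tensorPow_cfc]

theorem pinching_mul_tensorPow_cfc (f : ℝ → ℝ) (H : Op a) (K : Op (Fin n → a)) :
    pinching n H K * tensorPow n (cfc f H) = pinching n H (K * tensorPow n (cfc f H)) := by
  rw [pinching_apply, pinching_apply, Matrix.sum_mul]
  refine Finset.sum_congr rfl fun l _ => ?_
  simp only [Matrix.mul_assoc, tensorPow_cfc_mul_typeProj, typeProj_mul_tensorPow_cfc]

theorem commute_pinching_tensorPow_cfc (f : ℝ → ℝ) (H : Op a) (K : Op (Fin n → a)) :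
    Commute (pinching n H K) (tensorPow n (cfc f H)) := by
  rw [Commute, SemiconjBy, pinching_apply, Matrix.sum_mul, Matrix.mul_sum]
  refine Finset.sum_congr rfl fun l _ => ?_
  rw [Matrix.mul_assoc, typeProj_mul_tensorPow_cfc, ← Matrix.mul_assoc, ← Matrix.mul_assoc,
    tensorPow_cfc_mul_typeProj]
  simp

theorem pinching_posSemidef {H : Op a} {K : Op (Fin n → a)} (hK : K.PosSemidef) :
    (pinching n H K).PosSemidef :=
  Matrix.posSemidef_sum _ fun l _ => by
    simpa [(typeProj_posSemidef n H l).1.eq] using hK.mul_mul_conjTranspose_same (typeProj n H l)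

theorem trace_pinching {H : Op a} (hH : H.IsHermitian) (K : Op (Fin n → a)) :
    (pinching n H K).trace = K.trace := by
  rw [pinching_apply, Matrix.trace_sum]
  simp only [fun l => Matrix.trace_mul_comm (typeProj n H l * K) (typeProj n H l),
    ← Matrix.mul_assoc, typeProj_mul_self]
  rw [← Matrix.trace_sum, ← Matrix.sum_mul, sum_typeProj n hH, Matrix.one_mul]

/-- The pinching inequality. -/
theorem smul_pinching_sub_posSemidef {H : Op a} (hH : H.IsHermitian) {K : Op (Fin n → a)}
    (hK : K.PosSemidef) :
    ((((n + 1 : ℝ) ^ (eigs H).card : ℝ) : ℂ) • pinching n H K - K).PosSemidef := by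
  set m := (types n H).card with hm
  -- Expanding the square, the diagonal terms give 2m times the pinching of K and the cross terms
  -- give −2K.
  have h1 : (∑ l ∈ types n H, ∑ k ∈ types n H, (typeProj n H l - typeProj n H k) * K *
      (typeProj n H l - typeProj n H k)).PosSemidef := by
    refine Matrix.posSemidef_sum _ fun l _ => Matrix.posSemidef_sum _ fun k _ => ?_
    have := hK.mul_mul_conjTranspose_same (typeProj n H l - typeProj n H k)
    rwa [Matrix.conjTranspose_sub, (typeProj_posSemidef n H l).1.eq,
      (typeProj_posSemidef n H k).1.eq] at this
  have h2 : ∑ l ∈ types n H, ∑ k ∈ types n H, (typeProj n H l - typeProj n H k) * K *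
      (typeProj n H l - typeProj n H k) = (2 : ℂ) • ((m : ℂ) • pinching n H K - K) := by
    have e1 : ∑ l ∈ types n H, ∑ k ∈ types n H, typeProj n H l * K * typeProj n H k = K := by
      simp only [← Matrix.mul_sum, ← Matrix.sum_mul, sum_typeProj n hH, Matrix.mul_one,
        Matrix.one_mul]
    have e2 : ∑ l ∈ types n H, ∑ k ∈ types n H, typeProj n H k * K * typeProj n H l = K := by
      rw [Finset.sum_comm, e1]
    simp only [Matrix.sub_mul, Matrix.mul_sub, Finset.sum_sub_distrib, e1, e2, Finset.sum_const,
      ← pinching_apply, ← hm, ← Finset.smul_sum]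
    simp only [← Nat.cast_smul_eq_nsmul ℂ]
    module
  have h3 : ((m : ℂ) • pinching n H K - K).PosSemidef := by
    have := (h2 ▸ h1).smul (a := (2⁻¹ : ℂ)) (by positivity)
    rwa [smul_smul, inv_mul_cancel₀ two_ne_zero, one_smul] at this
  have h4 : (m : ℝ) ≤ (n + 1 : ℝ) ^ (eigs H).card := by exact_mod_cast card_types_le n H
  have h5 := (pinching_posSemidef (H := H) hK).smul
    (a := (((n + 1 : ℝ) ^ (eigs H).card - m : ℝ) : ℂ)) (by exact_mod_cast sub_nonneg.mpr h4)
  convert h3.add h5 using 1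
  push_cast
  module

/-! ### Adjoints of positive trace preserving maps -/

theorem trace_mul_adjointMap (N : Op a →ₗ[ℂ] Op b) {X : Op a} (hX : X.IsHermitian)
    (hNX : (N X).IsHermitian) (Y : Op b) : (X * adjointMap N Y).trace = (N X * Y).trace := by
  have := trace_adjointMap N X Y
  rwa [hX.eq, hNX.eq] at this

/-- By duality ⟨v, N†(Y) v⟩ = tr N(vv*) Y. Over ℂ a non-negative quadratic form is automatically
Hermitian. -/
theorem adjointMap_isPositiveMap {N : Op a →ₗ[ℂ] Op b} (hN : IsPositiveMap N) :
    IsPositiveMap (adjointMap N) := by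
  intro Y hY
  have h : ∀ v : a → ℂ, 0 ≤ star v ⬝ᵥ (adjointMap N Y *ᵥ v) := by
    intro v
    have hv := Matrix.posSemidef_vecMulVec_self_star v
    have h1 := trace_mul_nonneg (hN _ hv) hY
    rw [← trace_mul_adjointMap N hv.1 (hN _ hv).1, Matrix.vecMulVec_mul, Matrix.trace_vecMulVec,
      dotProduct_comm, ← Matrix.dotProduct_mulVec] at h1
    exact h1
  rw [← Matrix.isPositive_toEuclideanLin_iff, LinearMap.isPositive_iff_complex]
  intro x
  have hx : inner ℂ (Matrix.toEuclideanLin (adjointMap N Y) x) x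
      = star (star x.ofLp ⬝ᵥ (adjointMap N Y *ᵥ x.ofLp)) := by
    rw [EuclideanSpace.inner_eq_star_dotProduct, Matrix.ofLp_toLpLin, Matrix.toLin'_apply,
      Matrix.dotProduct_star, dotProduct_comm]
  have hx0 := Complex.le_def.mp (star_nonneg_iff.mpr (h x.ofLp))
  rw [← hx] at hx0
  exact ⟨Complex.ext rfl hx0.2, hx0.1⟩

theorem adjointMap_one {N : Op a →ₗ[ℂ] Op b} (hN : IsTracePreserving N) : adjointMap N 1 = 1 := by
  ext i j
  have : adjointMap N 1 i j = star (N (Matrix.single i j 1)).trace := by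
    rw [← Matrix.trace_conjTranspose]
    simp [adjointMap]
  rw [this, hN]
  by_cases h : i = j
  · subst h; simp
  · simp [h]

/-- Let P project onto the kernel of N(σ). Then tr σ N†(P) = 0 forces σ N†(P) = 0, and ρ = M*σ
transfers this to tr N(ρ) P = 0. -/
theorem supp_map_le {N : Op a →ₗ[ℂ] Op b} (hN : IsPositiveMap N) {ρ σ : Op a}
    (hρ : ρ.PosSemidef) (hσ : σ.PosSemidef) (h : supp ρ ≤ supp σ) : supp (N ρ) ≤ supp (N σ) := by
  rw [supp_le_supp_iff_trace (hN _ hρ) (hN _ hσ).1]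
  intro s hs
  have hP := eigProj_posSemidef (N σ) s
  have h0 : N σ * eigProj (N σ) s = 0 := by
    conv_lhs => enter [1]; rw [← cfc_fun_id (hN _ hσ).1]
    rw [cfc_mul_eigProj, hs]
    simp
  have hΦ := adjointMap_isPositiveMap hN _ hP
  have h1 : σ * adjointMap N (eigProj (N σ) s) = 0 := by
    refine mul_eq_zero_of_trace_re_eq_zero hσ hΦ ?_
    rw [trace_mul_adjointMap N hσ.1 (hN _ hσ).1, h0]
    simp
  obtain ⟨M, hM⟩ := supp_le_supp_iff.mp h
  have h2 : ρ = Mᴴ * σ := by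
    rw [← hρ.1.eq, hM, Matrix.conjTranspose_mul, hσ.1.eq]
  rw [← trace_mul_adjointMap N hρ.1 (hN _ hρ).1, h2, Matrix.mul_assoc, h1]
  simp

/-! ### The recovery inequality for finitely many copies -/

theorem msqrt_mul_msqrt {H : Op a} (hH : H.PosSemidef) : msqrt H * msqrt H = H := by
  rw [msqrt, ← cfc_mul _ _ _ (continuousOn_spectrum _ _) (continuousOn_spectrum _ _)]
  conv_rhs => rw [← cfc_fun_id hH.1]
  exact cfc_congr fun t ht => Real.mul_self_sqrt (spectrum_nonneg_of_nonneg hH.nonneg ht)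

theorem minvSqrt_mul_minvSqrt {H : Op a} (hH : H.PosSemidef) :
    minvSqrt H * minvSqrt H = cfc (fun t : ℝ => t⁻¹) H := by
  rw [minvSqrt, ← cfc_mul _ _ _ (continuousOn_spectrum _ _) (continuousOn_spectrum _ _)]
  refine cfc_congr fun t ht => ?_
  rw [← mul_inv, Real.mul_self_sqrt (spectrum_nonneg_of_nonneg hH.nonneg ht)]

/-- The conventions 0⁻¹ = 0 and `Real.log 0 = 0` make this valid on the kernel too. -/
theorem mlog_cfc_inv {H : Op a} (hH : H.IsHermitian) :
    mlog (cfc (fun t : ℝ => t⁻¹) H) = -mlog H := by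
  rw [mlog, mlog, ← cfc_neg, ← cfc_comp' Real.log (fun t : ℝ => t⁻¹) H
    (((Matrix.finite_real_spectrum (A := H)).image _).continuousOn _) (continuousOn_spectrum _ _)
    hH.isSelfAdjoint]
  exact cfc_congr fun t _ => Real.log_inv t

theorem supp_le_supp_cfc_inv {ρ H : Op a} (hH : H.IsHermitian) (h : supp ρ ≤ supp H) :
    supp ρ ≤ supp (cfc (fun t : ℝ => t⁻¹) H) := by
  refine supp_le_supp_iff.mpr ⟨H * ρ, ?_⟩
  have : cfc (fun t : ℝ => t⁻¹) H * H = H * cfc (fun t : ℝ => t⁻¹) H :=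
    (Commute.cfc_real (Commute.refl H) _).eq
  rw [← Matrix.mul_assoc, this, Matrix.mul_assoc, mul_cfc_inv_mul hH h]

theorem isState_map {a b : Type*} [Fintype a] [Fintype b] {N : Op a →ₗ[ℂ] Op b}
    (hN : IsPositiveMap N) (hTP : IsTracePreserving N) {ρ : Op a} (hρ : IsState ρ) :
    IsState (N ρ) :=
  ⟨hN _ hρ.1, by rw [hTP, hρ.2]⟩

theorem IsTensorStablePositive.isPositiveMap {b : Type*} {N : Op a →ₗ[ℂ] Op b}
    (hN : IsTensorStablePositive N) : IsPositiveMap N := by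
  intro X hX
  have h := hN 1 _ (tensorPow_posSemidef hX)
  rw [tensorMap_tensorPow] at h
  have h1 : N X = (tensorPow 1 (N X)).submatrix (fun i _ => i) fun i _ => i := by
    ext i j
    simp [tensorPow, tensor]
  rw [h1]
  exact h.submatrix _

/-- A lower bound for `tr ρ^{⊗n} log W`, where `W` is the image of `ρ^{⊗n}` under `N^{⊗n}` followed
by the pinching recovery map. -/
theorem pinchingRecovery_estimate (n : ℕ) {σ : Op a} (hσ : σ.PosSemidef) {N : Op a →ₗ[ℂ] Op b}
    (hN : IsPositiveMap N) (hNn : IsPositiveMap (tensorMap n N)) (hTP : IsTracePreserving N)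
    {ρ : Op a} (hρ : IsState ρ) (hsupp : supp ρ ≤ supp σ) {W : Op (Fin n → a)}
    (hW : W = pinchingRecovery n σ N (tensorMap n N (tensorPow n ρ))) :
    W.PosSemidef ∧ W.trace.re ≤ 1 ∧ supp (tensorPow n ρ) ≤ supp W ∧
      n * (ρ * mlog σ).trace.re + n * (N ρ * mlog (N ρ)).trace.re
          - n * (N ρ * mlog (N σ)).trace.re
          - ((eigs σ).card + (eigs (N σ)).card) * Real.log (n + 1)
        ≤ (tensorPow n ρ * mlog W).trace.re := by
  have hω := hN _ hσ
  have hρ' := isState_map hN hTP hρ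
  have hsupp' : supp (N ρ) ≤ supp (N σ) := supp_map_le hN hρ.1 hσ hsupp
  have hρn := tensorPow_isState (n := n) hρ
  have hρ'n := tensorPow_isState (n := n) hρ'
  have hmap : tensorMap n N (tensorPow n ρ) = tensorPow n (N ρ) := tensorMap_tensorPow N ρ
  set Φ := adjointMap (tensorMap n N) with hΦ
  have hΦpos : IsPositiveMap Φ := adjointMap_isPositiveMap hNn
  have hΦ1 : Φ 1 = 1 := adjointMap_one (tensorMap_isTracePreserving hTP)
  set τ := pinching n (N σ) (tensorPow n (N ρ)) with hτ
  have hτpos : τ.PosSemidef := pinching_posSemidef hρ'n.1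
  set T := tensorPow n (minvSqrt (N σ)) with hT
  set S := tensorPow n (msqrt σ) with hS
  set V := tensorPow n (cfc (fun t : ℝ => t⁻¹) (N σ)) with hV
  have hTT : T * T = V := by rw [hT, tensorPow_mul, minvSqrt_mul_minvSqrt hω]
  have hSS : S * S = tensorPow n σ := by rw [hS, tensorPow_mul, msqrt_mul_msqrt hσ]
  have hTH : Tᴴ = T := tensorPow_cfc_isHermitian _ _
  have hSH : Sᴴ = S := tensorPow_cfc_isHermitian _ _
  have hτT : τ * T = T * τ := (commute_pinching_tensorPow_cfc _ _ _).eq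
  have hτV : Commute τ V := commute_pinching_tensorPow_cfc _ _ _
  have hVpos : V.PosSemidef := tensorPow_posSemidef
    (cfc_posSemidef fun s => inv_nonneg.mpr (eigs_nonneg hω s))
  have hX : T * τ * T = τ * V := by rw [← hτT, Matrix.mul_assoc, hTT]
  have hXpos : (τ * V).PosSemidef := by
    rw [← hX]
    simpa [hTH] using hτpos.mul_mul_conjTranspose_same T
  set Z := pinching n σ (Φ (τ * V)) with hZ
  have hZpos : Z.PosSemidef := pinching_posSemidef (hΦpos _ hXpos)
  have hZσ : Commute Z (tensorPow n σ) := by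
    have := commute_pinching_tensorPow_cfc (fun t : ℝ => t) σ (Φ (τ * V))
    rwa [cfc_fun_id hσ.1] at this
  have hWeq : W = pinching n σ (S * Φ (τ * V) * S) := by
    rw [hW, hmap, ← hX]
    simp only [pinchingRecovery, LinearMap.comp_apply, tensorMap_petz]
    rfl
  have hWS : W = S * Z * S := by
    rw [hWeq, hZ, hS, msqrt, ← pinching_mul_tensorPow_cfc, ← tensorPow_cfc_mul_pinching]
  have hWZ : W = Z * tensorPow n σ := by
    have : Z * S = S * Z := (commute_pinching_tensorPow_cfc _ _ _).eq
    rw [hWS, ← this, Matrix.mul_assoc, hSS]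
  -- Moving Φ to the other side turns tr σ^{⊗n} Φ(τV) into tr N(σ)^{⊗n} V τ; the support projector
  -- N(σ)^{⊗n} V fixes N(ρ)^{⊗n}.
  have hWtr : W.trace = 1 := by
    rw [hWeq, trace_pinching hσ.1, Matrix.mul_assoc, Matrix.trace_mul_comm, Matrix.mul_assoc, hSS,
      Matrix.trace_mul_comm, hΦ, trace_mul_adjointMap _ (tensorPow_posSemidef hσ).1
        (hNn _ (tensorPow_posSemidef hσ)).1, tensorMap_tensorPow, hτV.eq, ← Matrix.mul_assoc,
      hV, tensorPow_mul, mul_cfc hω.1, hτ, tensorPow_cfc_mul_pinching, trace_pinching hω.1,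
      tensorPow_mul, ← mul_cfc hω.1, Matrix.mul_assoc, mul_cfc_inv_mul hω.1 hsupp', hρ'n.2]
  have hlog : ∀ d : ℕ, Real.log ((n + 1 : ℝ) ^ d) = d * Real.log (n + 1) := fun d =>
    Real.log_pow _ d
  have hpos : ∀ d : ℕ, (0 : ℝ) < (n + 1 : ℝ) ^ d := fun d => by positivity
  -- With the identity as Φ this is plain operator monotonicity. In the following four applications
  -- the support inclusions s1, s2, s3 feed the next hypothesis.
  obtain ⟨s1, i1⟩ := trace_mul_mlog_le (Φ := LinearMap.id) (fun _ h => h) rfl hρ'n.1 hτpos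
    (hpos _) (smul_pinching_sub_posSemidef hω.1 hρ'n.1) hρ'n hρ'n.1 (fun _ => rfl) le_rfl
  obtain ⟨s2, i2⟩ := trace_mul_mlog_mul hρ'n.1 hτpos hVpos hτV s1
    (supp_tensorPow_le (supp_le_supp_cfc_inv hω.1 hsupp'))
  -- The only use of Jensen's inequality for a nontrivial Φ: it passes from N(ρ)^{⊗n} tested on
  -- log(τV) to ρ^{⊗n} tested on log Z.
  obtain ⟨s3, i3⟩ := trace_mul_mlog_le hΦpos hΦ1 hXpos hZpos (hpos _)
    (smul_pinching_sub_posSemidef hσ.1 (hΦpos _ hXpos)) hρn hρ'n.1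
    (fun K => by
      rw [hΦ, trace_mul_adjointMap _ hρn.1.1 (hNn _ hρn.1).1, hmap]) s2
  obtain ⟨s4, i4⟩ := trace_mul_mlog_mul hρn.1 hZpos (tensorPow_posSemidef hσ) hZσ s3
    (supp_tensorPow_le hsupp)
  rw [← hWZ] at s4 i4
  refine ⟨?_, by rw [hWtr, Complex.one_re], s4, ?_⟩
  · rw [hWS]
    simpa [hSH] using hZpos.mul_mul_conjTranspose_same S
  · rw [trace_tensorPow_mul_mlog hρ hσ hsupp] at i4
    rw [trace_tensorPow_mul_mlog hρ' hρ'.1 le_rfl, hlog] at i1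
    rw [hlog] at i3
    rw [hV, trace_tensorPow_mul_mlog hρ'
      (cfc_posSemidef fun s => inv_nonneg.mpr (eigs_nonneg hω s))
      (supp_le_supp_cfc_inv hω.1 hsupp'), mlog_cfc_inv hω.1, Matrix.mul_neg, Matrix.trace_neg,
      Complex.neg_re] at i2
    linarith

/-! ### Real-valued relative entropies and the limit of many copies -/

theorem relEntropy_eq_coe {X Y : Op a} (h : supp X ≤ supp Y) :
    relEntropy X Y = (((X * mlog X).trace.re - (X * mlog Y).trace.re : ℝ) : EReal) := by
  rw [relEntropy, if_pos h, Matrix.mul_sub, Matrix.trace_sub, Complex.sub_re]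

theorem tendsto_add_log_div (x c : ℝ) :
    Tendsto (fun n : ℕ => x + c * (Real.log (n + 1) / n)) atTop (nhds x) := by
  -- The offset −1 turns the denominator at n + 1 into n.
  have h1 := (Real.tendsto_pow_log_div_mul_add_atTop 1 (-1) 1 one_ne_zero).comp
    (tendsto_atTop_add_const_right atTop (1 : ℝ) (tendsto_natCast_atTop_atTop (R := ℝ)))
  simpa [Function.comp_def] using (h1.const_mul c).const_add x

end QInfo

theorem proposition1 {a b : Type*} [Fintype a] [DecidableEq a] [Fintype b] [DecidableEq b]
    (σ : Op a) (hσ : σ.PosSemidef)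
    (N : Op a →ₗ[ℂ] Op b) (hN : IsTensorStablePositive N) (hTP : IsTracePreserving N)
    (ρ : Op a) (hρ : IsState ρ) :
    (supp ρ ≤ supp σ →
      liminf (fun n : ℕ => ((1 / (n : ℝ) : ℝ) : EReal) *
          relEntropy (tensorPow n ρ)
            ((pinchingRecovery n σ N ∘ₗ tensorMap n N) (tensorPow n ρ))) atTop
        ≤ relEntropy ρ σ - relEntropy (N ρ) (N σ)) ∧
    relEntropy (N ρ) (N σ) ≤ relEntropy ρ σ := by
  by_cases hsupp : supp ρ ≤ supp σ
  swap
  · exact ⟨fun h => absurd h hsupp, by rw [relEntropy.eq_def ρ σ, if_neg hsupp]; exact le_top⟩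
  have hN1 : IsPositiveMap N := hN.isPositiveMap
  rw [relEntropy_eq_coe hsupp, relEntropy_eq_coe (supp_map_le hN1 hρ.1 hσ hsupp)]
  set x := (ρ * mlog ρ).trace.re - (ρ * mlog σ).trace.re with hx
  set y := (N ρ * mlog (N ρ)).trace.re - (N ρ * mlog (N σ)).trace.re with hy
  set d : ℕ → ℝ := fun n => (tensorPow n ρ * mlog (tensorPow n ρ)).trace.re - (tensorPow n ρ *
    mlog ((pinchingRecovery n σ N ∘ₗ tensorMap n N) (tensorPow n ρ))).trace.re with hd
  have hest := fun n => pinchingRecovery_estimate n hσ hN1 (hN n) hTP hρ hsupp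
    (W := (pinchingRecovery n σ N ∘ₗ tensorMap n N) (tensorPow n ρ)) rfl
  have hd0 : ∀ n, 0 ≤ d n := fun n => sub_nonneg.mpr
    (trace_mul_mlog_le_trace_mul_mlog_self (tensorPow_isState hρ) (hest n).1 (hest n).2.1
      (hest n).2.2.1)
  have hle : ∀ n : ℕ, 0 < n → 1 / (n : ℝ) * d n ≤
      (x - y) + ((eigs σ).card + (eigs (N σ)).card) * (Real.log (n + 1) / n) := by
    intro n hn
    have hn' : (0 : ℝ) < n := by exact_mod_cast hn
    have h1 := (hest n).2.2.2
    have h2 := trace_tensorPow_mul_mlog (n := n) hρ hρ.1 le_rfl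
    have h3 : d n ≤ n * (x - y) + ((eigs σ).card + (eigs (N σ)).card) * Real.log (n + 1) := by
      simp only [hd, hx, hy, h2]
      linarith
    calc 1 / (n : ℝ) * d n ≤ 1 / (n : ℝ) *
          (n * (x - y) + ((eigs σ).card + (eigs (N σ)).card) * Real.log (n + 1)) := by gcongr
      _ = _ := by field_simp
  have hlim := tendsto_add_log_div (x - y) ((eigs σ).card + (eigs (N σ)).card)
  constructor
  · intro _
    rw [← EReal.coe_sub, ← ((continuous_coe_real_ereal.tendsto _).comp hlim).liminf_eq]
    refine liminf_le_liminf ?_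
    -- Only n > 0 matters; at n = 0 the factor 1/n is 0 by convention.
    filter_upwards [eventually_gt_atTop 0] with n hn
    rw [relEntropy_eq_coe (hest n).2.2.1, ← EReal.coe_mul]
    exact EReal.coe_le_coe_iff.mpr (hle n hn)
  -- The limit x − y of the upper bounds is non-negative because each bound dominates a non-negative
  -- relative entropy.
  · refine EReal.coe_le_coe_iff.mpr (sub_nonneg.mp (ge_of_tendsto hlim ?_))
    filter_upwards [eventually_gt_atTop 0] with n hn
    exact le_trans (mul_nonneg (by positivity) (hd0 n)) (hle n hn)
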